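/- Let $L\ge 3$, and let $\mathcal X$ be the cell complex of the rectangular lattice with $L$ rows and $L+1$ columns of vertices (vertices, edges between horizontally or vertically neighbouring vertices, and unit-square plaquettes). Let $\mathcal A$ be its $1$-dimensional subcomplex consisting of the left and right side edges and their incident vertices (the leftmost and rightmost columns). Let $B$ be the set of vertices of $\mathcal A$, and let $G=(V,E)$ be the graph of $\mathcal X$ with the edges of $\mathcal A$ removed (all vertices are kept). For a set $J$ of edges, the $J$-degree of a vertex $v$ is the number of edges in $J$ incident to $v$. For $D\subset V$ disjoint from $B$, a $D$-join of $G$ relative to $B$ is a set $J\subset E$ such that every vertex in $D$ has odd $J$-degree and every vertex in $V\setminus(D\cup B)$ has even $J$-degree. A $2$-chain $c$ over $\mathbb F_2$ is a set of plaquettes of $\mathcal X$; its relative boundary $\partial c$ is the set of edges of $\mathcal X$ not in $\mathcal A$ that lie on an odd number of plaquettes in $c$. Let $\oplus$ denote symmetric difference. Then for every $D\subset V$ disjoint from $B$: 1. $G$ has a minimum-size $D$-join $J$ relative to $B$ such that every vertex in $D$ has $J$-degree $1$. 2. For every minimum-size $D$-join $J$ of $G$ relative to $B$ there is a $2$-chain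 $c$ in $\mathcal X$ such that $J'=J\oplus\partial c$ satisfies $|J'|=|J|$ and every vertex in $D$ has $J'$-degree $1$. The same statement holds with $\mathcal X,\mathcal A$ replaced by the dual lattice $\mathcal X^\ast$ and its subcomplex $\mathcal A^\ast$. Here $\mathcal X^\ast$ is the rectangular lattice with $L+1$ rows and $L$ columns of vertices, where the vertices of its $L-1$ inner rows are the centres of the plaquettes of $\mathcal X$, and $\mathcal A^\ast$ consists of the top and bottom side edges of $\mathcal X^\ast$ and their incident vertices. -/

import Mathlib

namespace PlanarCode

/-! Relative joins in a graph. -/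

/-- The `J`-degree of `v`: the number of edges in `J` incident to `v`. -/
def jDegree {V : Type*} [DecidableEq V] (J : Finset (Sym2 V)) (v : V) : ℕ :=
  (J.filter fun e => v ∈ e).card

/-- `J` is a `D`-join of `G` relative to `B`: a set of edges of `G` with odd `J`-degree at each
vertex of `D` and even `J`-degree at each vertex outside `D ∪ B`. -/
structure IsRelJoin {V : Type*} [DecidableEq V] (G : SimpleGraph V) (B : Set V) (D : Finset V)
    (J : Finset (Sym2 V)) : Prop where
  subset_edges : ∀ e ∈ J, e ∈ G.edgeSet
  odd_degree : ∀ v ∈ D, Odd (jDegree J v)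
  even_degree : ∀ v, v ∉ D → v ∉ B → Even (jDegree J v)

/-- `J` is a minimum-size `D`-join of `G` relative to `B`. -/
def IsMinRelJoin {V : Type*} [DecidableEq V] (G : SimpleGraph V) (B : Set V) (D : Finset V)
    (J : Finset (Sym2 V)) : Prop :=
  IsRelJoin G B D J ∧ ∀ K : Finset (Sym2 V), IsRelJoin G B D K → J.card ≤ K.card

/-! The cell complex of a rectangular lattice and relative boundaries. -/

/-- Vertices of the rectangular lattice with `m` rows and `n` columns of vertices;
`(i, j)` is the vertex in row `i` and column `j`. -/
abbrev Vertex (m n : ℕ) : Type := Fin m × Fin n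

/-- The graph (1-skeleton) of the rectangular lattice with `m` rows and `n` columns of
vertices. -/
def lattice (m n : ℕ) : SimpleGraph (Vertex m n) :=
  (SimpleGraph.pathGraph m).boxProd (SimpleGraph.pathGraph n)

/-- Plaquettes (unit square faces) of the lattice; `(i, j)` is the plaquette with corners
`(i, j)`, `(i, j + 1)`, `(i + 1, j)`, `(i + 1, j + 1)`. -/
abbrev Plaquette (m n : ℕ) : Type := Fin (m - 1) × Fin (n - 1)

/-- The corner `(i + a, j + b)` of the plaquette `(i, j)`, for `a, b ∈ {0, 1}`. -/
def corner {m n : ℕ} (p : Plaquette m n) (a b : Fin 2) : Vertex m n :=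
  (⟨p.1.val + a.val, by omega⟩, ⟨p.2.val + b.val, by omega⟩)

/-- The four edges on the boundary of a plaquette. -/
def plaquetteEdges {m n : ℕ} (p : Plaquette m n) : Finset (Sym2 (Vertex m n)) :=
  {s(corner p 0 0, corner p 0 1), s(corner p 1 0, corner p 1 1),
    s(corner p 0 0, corner p 1 0), s(corner p 0 1, corner p 1 1)}

/-- The lattice graph with the edges of the 1-dimensional subcomplex `A` removed (all vertices are
kept). -/
def relGraph {m n : ℕ} (A : (lattice m n).Subgraph) : SimpleGraph (Vertex m n) :=
  (lattice m n).deleteEdges A.edgeSet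

open Classical in
/-- The relative boundary of a 2-chain `c`. Chains over `𝔽₂` are identified with their supports,
so `c` is a set of plaquettes, and its relative boundary is the set of the lattice edges outside `A`
that lie on an odd number of plaquettes of `c`. -/
noncomputable def relBoundary {m n : ℕ} (A : (lattice m n).Subgraph)
    (c : Finset (Plaquette m n)) : Finset (Sym2 (Vertex m n)) :=
  Finset.univ.filter fun e =>
    e ∈ (lattice m n).edgeSet ∧ e ∉ A.edgeSet ∧
      Odd (c.filter fun p => e ∈ plaquetteEdges p).card

/-! The planar surface code of distance `L`. The primal complex is the lattice with `L` rows and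
`L + 1` columns of vertices. The dual complex is the lattice with `L + 1` rows and `L` columns of
vertices: for `1 ≤ i ≤ L - 1` its vertex `(i, j)` is the centre of the primal plaquette
`(i - 1, j)`, and its rows `0` and `L` lie above and below the primal lattice. The dual edge
`(i, j) — (i + 1, j)` crosses the primal edge `(i, j) — (i, j + 1)`, the dual edge
`(i, j) — (i, j + 1)` with `1 ≤ i ≤ L - 1` crosses the primal edge
`(i - 1, j + 1) — (i, j + 1)`, and the dual plaquette `(i, j)` is centred at the primal vertex
`(i, j + 1)`. -/

/-- The subcomplex of the primal lattice: the left and right side edges (in columns `0` and `L`)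
with their incident vertices. -/
def primalSides (L : ℕ) : (lattice L (L + 1)).Subgraph where
  verts := {v | v.2.val = 0 ∨ v.2.val = L}
  Adj u v := (lattice L (L + 1)).Adj u v ∧ u.2 = v.2 ∧ (u.2.val = 0 ∨ u.2.val = L)
  adj_sub h := h.1
  edge_vert h := h.2.2
  symm := ⟨fun _ _ h => ⟨h.1.symm, h.2.1.symm, h.2.1 ▸ h.2.2⟩⟩

/-- The subcomplex of the dual lattice: the top and bottom side edges (in rows `0` and `L`)
with their incident vertices. -/
def dualSides (L : ℕ) : (lattice (L + 1) L).Subgraph where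
  verts := {v | v.1.val = 0 ∨ v.1.val = L}
  Adj u v := (lattice (L + 1) L).Adj u v ∧ u.1 = v.1 ∧ (u.1.val = 0 ∨ u.1.val = L)
  adj_sub h := h.1
  edge_vert h := h.2.2
  symm := ⟨fun _ _ h => ⟨h.1.symm, h.2.1.symm, h.2.1 ▸ h.2.2⟩⟩

end PlanarCode

namespace PlanarCode

/-! Midpoint coordinates: the vertices of the lattice are the points with two even coordinates, the
midpoints of the edges have one odd coordinate, and the centres of the plaquettes have two. -/

/-! Work inside the minimum joins `J ⊕ ∂c` and choose one with the fewest vertices of `D` of degree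
other than 1. Such a vertex `v` has degree 3, so two of its edges lie on a common plaquette. Adding
the boundary of that plaquette cannot shorten the join, so those two are its only edges in the join
and none of its edges lies in `A` (`IsMinRelJoin.isFlippable`). The flip preserves size, lowers the
degree of `v` to 1 and alters no other degree except at the opposite corner `w`. By the choice of
the join, `w` is in `D` and now has degree 3.

The defect can thus be pushed diagonally forever, leaving each vertex through its third edge. Call a
visited vertex a horizontal or vertical mirror according to the majority among its one or three
edges; no flip of the walk changes this. The defect moves like a light ray among fixed mirrors, so
it is reversible and never runs back along a diagonal (`IsBranchWalk.not_reversed`).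

Since `D` is finite, some vertices are visited infinitely often. At one in the extreme row, the edge
left over by one visit forces the next arrival to run back along the diagonal of departure, a
contradiction (`IsBranchWalk.not_forall_mem`). -/

/-- The four points next to `p`. -/
def cross (p : ℤ × ℤ) : Set (ℤ × ℤ) :=
  {x | (x.2 = p.2 ∧ (x.1 = p.1 + 1 ∨ x.1 = p.1 - 1)) ∨
    (x.1 = p.1 ∧ (x.2 = p.2 + 1 ∨ x.2 = p.2 - 1))}

theorem mem_cross {p x : ℤ × ℤ} : x ∈ cross p ↔
    (x.2 = p.2 ∧ (x.1 = p.1 + 1 ∨ x.1 = p.1 - 1)) ∨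
      (x.1 = p.1 ∧ (x.2 = p.2 + 1 ∨ x.2 = p.2 - 1)) :=
  Iff.rfl

open Classical in
/-- The indicator of a proposition. -/
noncomputable def ind (P : Prop) : ℕ := if P then 1 else 0

theorem ind_true : ind True = 1 := if_pos trivial

theorem ind_false : ind False = 0 := if_neg not_false

/-- The number of points of `K` next to `v`. -/
noncomputable def degreeAt (K : Set (ℤ × ℤ)) (v : ℤ × ℤ) : ℕ :=
  ind ((v.1 + 1, v.2) ∈ K) + ind ((v.1 - 1, v.2) ∈ K) +
    ind ((v.1, v.2 + 1) ∈ K) + ind ((v.1, v.2 - 1) ∈ K)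

/-- The edges of `K` at `v` are one edge or three edges with a horizontal majority. -/
def IsHorizontal (K : Set (ℤ × ℤ)) (v : ℤ × ℤ) : Prop :=
  ((v.1, v.2 + 1) ∈ K ∨ (v.1, v.2 - 1) ∈ K) ∧ ¬((v.1 + 1, v.2) ∈ K ∧ (v.1 - 1, v.2) ∈ K)

/-- A diagonal direction. -/
def IsDiag (d : ℤ × ℤ) : Prop := (d.1 = 1 ∨ d.1 = -1) ∧ (d.2 = 1 ∨ d.2 = -1)

theorem IsDiag.neg {d : ℤ × ℤ} (hd : IsDiag d) : IsDiag (-d) := by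
  obtain ⟨h1, h2⟩ := hd
  constructor <;> simp only [Prod.fst_neg, Prod.snd_neg] <;> omega

theorem IsDiag.degreeAt_eq {d : ℤ × ℤ} (hd : IsDiag d) (K : Set (ℤ × ℤ)) (v : ℤ × ℤ) :
    degreeAt K v =
      ind ((v.1 + d.1, v.2) ∈ K) + ind ((v.1 - d.1, v.2) ∈ K) +
      ind ((v.1, v.2 + d.2) ∈ K) + ind ((v.1, v.2 - d.2) ∈ K) := by
  obtain ⟨h1 | h1, h2 | h2⟩ := hd <;> unfold degreeAt <;> rw [h1, h2] <;>
    simp only [sub_neg_eq_add, ← sub_eq_add_neg] <;> ring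

theorem IsDiag.isHorizontal_iff {d : ℤ × ℤ} (hd : IsDiag d) (K : Set (ℤ × ℤ)) (v : ℤ × ℤ) :
    IsHorizontal K v ↔ ((v.1, v.2 + d.2) ∈ K ∨ (v.1, v.2 - d.2) ∈ K) ∧
      ¬((v.1 + d.1, v.2) ∈ K ∧ (v.1 - d.1, v.2) ∈ K) := by
  obtain ⟨h1 | h1, h2 | h2⟩ := hd <;> unfold IsHorizontal <;> rw [h1, h2] <;>
    simp only [sub_neg_eq_add, ← sub_eq_add_neg] <;> tauto

/-- The vertex `v` has exactly three edges in `K`, two of which lie on the plaquette `v + d`. -/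
structure IsBranch (K : Set (ℤ × ℤ)) (v d : ℤ × ℤ) : Prop where
  diag : IsDiag d
  vert : (v.1 + d.1, v.2) ∈ K
  horz : (v.1, v.2 + d.2) ∈ K
  third : (v.1 - d.1, v.2) ∈ K ↔ (v.1, v.2 - d.2) ∉ K

theorem IsBranch.isHorizontal_iff {K : Set (ℤ × ℤ)} {v d : ℤ × ℤ} (h : IsBranch K v d) :
    IsHorizontal K v ↔ (v.1, v.2 - d.2) ∈ K := by
  rw [h.diag.isHorizontal_iff]
  simp only [h.vert, h.horz, h.third]
  tauto

theorem IsBranch.degreeAt_eq {K : Set (ℤ × ℤ)} {v d : ℤ × ℤ} (h : IsBranch K v d) :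
    degreeAt K v = 3 := by
  rw [h.diag.degreeAt_eq]
  simp only [h.vert, h.horz, h.third]
  by_cases h' : (v.1, v.2 - d.2) ∈ K <;> simp [h', ind_true, ind_false]

theorem exists_isBranch {K : Set (ℤ × ℤ)} {v : ℤ × ℤ} (hodd : Odd (degreeAt K v))
    (hne : degreeAt K v ≠ 1) : ∃ d, IsBranch K v d := by
  obtain ⟨a, b⟩ := v
  by_cases h1 : (a + 1, b) ∈ K <;> by_cases h2 : (a - 1, b) ∈ K <;>
    by_cases h3 : (a, b + 1) ∈ K <;> by_cases h4 : (a, b - 1) ∈ K <;>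
    simp only [degreeAt, h1, h2, h3, h4, ind_true, ind_false] at hodd hne <;>
    -- Three directions cover the four possible missing edges, since `(1, 1)` serves two of them.
    first
      | exact absurd rfl hne
      | exact absurd hodd (by decide)
      | exact ⟨(1, 1), ⟨by simp [IsDiag], by simpa using h1, by simpa using h3,
          by simp [h2, h4]⟩⟩
      | exact ⟨(1, -1), ⟨by simp [IsDiag], by simpa using h1, by simpa [← sub_eq_add_neg] using h4,
          by simp [h2, h3]⟩⟩
      | exact ⟨(-1, 1), ⟨by simp [IsDiag], by simpa [← sub_eq_add_neg] using h2, by simpa using h3,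
          by simp [h1, h4]⟩⟩

/-! ### Plaquette flips, degrees and mirrors -/

/-- Flipping the plaquette with centre `p`. -/
def flipAt (K : Set (ℤ × ℤ)) (p : ℤ × ℤ) : Set (ℤ × ℤ) := symmDiff K (cross p)

theorem mem_flipAt {K : Set (ℤ × ℤ)} {p x : ℤ × ℤ} :
    x ∈ flipAt K p ↔ ¬(x ∈ K ↔ x ∈ cross p) := by
  unfold flipAt
  rw [Set.mem_symmDiff]
  tauto

theorem mem_flipAt_of_notMem {K : Set (ℤ × ℤ)} {p x : ℤ × ℤ} (h : x ∉ cross p) :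
    x ∈ flipAt K p ↔ x ∈ K := by
  rw [mem_flipAt]; tauto

theorem mem_flipAt_of_mem {K : Set (ℤ × ℤ)} {p x : ℤ × ℤ} (h : x ∈ cross p) :
    x ∈ flipAt K p ↔ x ∉ K := by
  rw [mem_flipAt]; tauto

section Corner

variable {K : Set (ℤ × ℤ)} {v d p : ℤ × ℤ}

theorem IsDiag.mem_flipAt_vert (hd : IsDiag d) (hp : v + d = p) :
    (v.1 + d.1, v.2) ∈ flipAt K p ↔ (v.1 + d.1, v.2) ∉ K := by
  subst hp
  apply mem_flipAt_of_mem
  obtain ⟨a, b⟩ := v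
  obtain ⟨s, t⟩ := d
  simp only [IsDiag, Prod.mk_add_mk, mem_cross, true_and] at *
  omega

theorem IsDiag.mem_flipAt_horz (hd : IsDiag d) (hp : v + d = p) :
    (v.1, v.2 + d.2) ∈ flipAt K p ↔ (v.1, v.2 + d.2) ∉ K := by
  subst hp
  apply mem_flipAt_of_mem
  obtain ⟨a, b⟩ := v
  obtain ⟨s, t⟩ := d
  simp only [IsDiag, Prod.mk_add_mk, mem_cross, true_and] at *
  omega

theorem IsDiag.mem_flipAt_vert' (hd : IsDiag d) (hp : v + d = p) :
    (v.1 - d.1, v.2) ∈ flipAt K p ↔ (v.1 - d.1, v.2) ∈ K := by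
  subst hp
  apply mem_flipAt_of_notMem
  obtain ⟨a, b⟩ := v
  obtain ⟨s, t⟩ := d
  simp only [IsDiag, Prod.mk_add_mk, mem_cross] at *
  omega

theorem IsDiag.mem_flipAt_horz' (hd : IsDiag d) (hp : v + d = p) :
    (v.1, v.2 - d.2) ∈ flipAt K p ↔ (v.1, v.2 - d.2) ∈ K := by
  subst hp
  apply mem_flipAt_of_notMem
  obtain ⟨a, b⟩ := v
  obtain ⟨s, t⟩ := d
  simp only [IsDiag, Prod.mk_add_mk, mem_cross] at *
  omega

end Corner

theorem mem_cross_of_step {v : ℤ × ℤ} :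
    (v.1 + 1, v.2) ∈ cross v ∧ (v.1 - 1, v.2) ∈ cross v ∧ (v.1, v.2 + 1) ∈ cross v ∧
      (v.1, v.2 - 1) ∈ cross v := by
  simp [cross]

theorem degreeAt_congr {K K' : Set (ℤ × ℤ)} {u : ℤ × ℤ} (h : ∀ x ∈ cross u, x ∈ K' ↔ x ∈ K) :
    degreeAt K' u = degreeAt K u := by
  obtain ⟨h1, h2, h3, h4⟩ := mem_cross_of_step (v := u)
  simp only [degreeAt, h _ h1, h _ h2, h _ h3, h _ h4]

theorem isHorizontal_congr {K K' : Set (ℤ × ℤ)} {u : ℤ × ℤ} (h : ∀ x ∈ cross u, x ∈ K' ↔ x ∈ K) :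
    IsHorizontal K' u ↔ IsHorizontal K u := by
  obtain ⟨h1, h2, h3, h4⟩ := mem_cross_of_step (v := u)
  simp only [IsHorizontal, h _ h1, h _ h2, h _ h3, h _ h4]

/-- The vertices in the colour class of `v` on the chessboard of all vertices. -/
def SameClass (u v : ℤ × ℤ) : Prop :=
  u.1 % 2 = v.1 % 2 ∧ (u.1 + u.2) % 4 = (v.1 + v.2) % 4

/-- Edges at a vertex in the class of `v` are not affected by a flip at `v + d` unless the vertex is
on the diagonal of the flipped plaquette through `v`. -/
theorem mem_flipAt_of_sameClass {K : Set (ℤ × ℤ)} {u v d x : ℤ × ℤ} (hd : IsDiag d)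
    (hu : SameClass u v) (h1 : u ≠ v) (h2 : u ≠ v + d + d) (hx : x ∈ cross u) :
    x ∈ flipAt K (v + d) ↔ x ∈ K := by
  apply mem_flipAt_of_notMem
  obtain ⟨a, b⟩ := v
  obtain ⟨s, t⟩ := d
  obtain ⟨u1, u2⟩ := u
  obtain ⟨x1, x2⟩ := x
  simp only [SameClass, mem_cross, IsDiag, ne_eq, Prod.mk.injEq, Prod.mk_add_mk] at *
  omega

/-- The state of the four edges on a plaquette which has exactly two edges in `K`, and these are
incident to `v`. -/
structure IsFlippable (K : Set (ℤ × ℤ)) (v d : ℤ × ℤ) : Prop where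
  vert : (v.1 + d.1, v.2) ∈ K
  horz : (v.1, v.2 + d.2) ∈ K
  vert' : (v.1 + d.1, v.2 + d.2 + d.2) ∉ K
  horz' : (v.1 + d.1 + d.1, v.2 + d.2) ∉ K

/-- Each of the two remaining corners of the plaquette lies on one edge in `K` and one edge outside,
which the flip exchanges. Vertices off the plaquette meet none of its edges. -/
theorem degreeAt_flipAt {K : Set (ℤ × ℤ)} {u v d : ℤ × ℤ} (hd : IsDiag d)
    (hf : IsFlippable K v d) (h1 : u.1 % 2 = v.1 % 2) (h2 : u.2 % 2 = v.2 % 2)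
    (huv : u ≠ v) (huw : u ≠ v + d + d) :
    degreeAt (flipAt K (v + d)) u = degreeAt K u := by
  by_cases hx : u = (v.1 + d.1 + d.1, v.2)
  · have hd' : IsDiag (-d.1, d.2) := by unfold IsDiag at *; simp only; omega
    have hp : u + (-d.1, d.2) = v + d := by
      rw [hx]; ext <;> simp
    have e1 : (u.1 + -d.1, u.2) = (v.1 + d.1, v.2) := by rw [hx]; simp
    have e2 : (u.1, u.2 + d.2) = (v.1 + d.1 + d.1, v.2 + d.2) := by rw [hx]
    have m1 := hd'.mem_flipAt_vert (K := K) hp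
    have m2 := hd'.mem_flipAt_horz (K := K) hp
    rw [hd'.degreeAt_eq, hd'.degreeAt_eq K]
    simp only [m1, m2, hd'.mem_flipAt_vert' hp, hd'.mem_flipAt_horz' hp]
    simp only [e1, e2, hf.vert, hf.horz', not_true, not_false_iff, ind_true, ind_false]
    ring
  by_cases hy : u = (v.1, v.2 + d.2 + d.2)
  · have hd' : IsDiag (d.1, -d.2) := by unfold IsDiag at *; simp only; omega
    have hp : u + (d.1, -d.2) = v + d := by
      rw [hy]; ext <;> simp
    have e1 : (u.1 + d.1, u.2) = (v.1 + d.1, v.2 + d.2 + d.2) := by rw [hy]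
    have e2 : (u.1, u.2 + -d.2) = (v.1, v.2 + d.2) := by rw [hy]; simp
    have m1 := hd'.mem_flipAt_vert (K := K) hp
    have m2 := hd'.mem_flipAt_horz (K := K) hp
    rw [hd'.degreeAt_eq, hd'.degreeAt_eq K]
    simp only [m1, m2, hd'.mem_flipAt_vert' hp, hd'.mem_flipAt_horz' hp]
    simp only [e1, e2, hf.horz, hf.vert', not_true, not_false_iff, ind_true, ind_false]
    ring
  refine degreeAt_congr fun z hz => mem_flipAt_of_notMem ?_
  obtain ⟨a, b⟩ := v
  obtain ⟨s, t⟩ := d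
  obtain ⟨x, y⟩ := u
  obtain ⟨z1, z2⟩ := z
  simp only [mem_cross, IsDiag, ne_eq, Prod.mk.injEq, Prod.mk_add_mk] at *
  omega

/-- `d'` is the direction `d` after reflection in a horizontal or a vertical mirror at `v`. -/
def IsTurn (K : Set (ℤ × ℤ)) (v d d' : ℤ × ℤ) : Prop :=
  (IsHorizontal K v ∧ d' = (-d.1, d.2)) ∨ (¬IsHorizontal K v ∧ d' = (d.1, -d.2))

section Branch

variable {K : Set (ℤ × ℤ)} {v d : ℤ × ℤ}

theorem IsBranch.degreeAt_flipAt (hb : IsBranch K v d) :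
    degreeAt (flipAt K (v + d)) v = 1 := by
  have hd := hb.diag
  rw [hd.degreeAt_eq]
  simp only [hd.mem_flipAt_vert, hd.mem_flipAt_horz, hd.mem_flipAt_vert', hd.mem_flipAt_horz',
    hb.vert, hb.horz, hb.third]
  by_cases h' : (v.1, v.2 - d.2) ∈ K <;> simp [h', ind_true, ind_false]

/-- The flip removes one edge of each orientation; the survivor has the orientation of the former
majority. -/
theorem IsBranch.isHorizontal_flipAt (hb : IsBranch K v d) :
    IsHorizontal (flipAt K (v + d)) v ↔ IsHorizontal K v := by
  have hd := hb.diag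
  rw [hd.isHorizontal_iff, hd.isHorizontal_iff]
  simp only [hd.mem_flipAt_vert, hd.mem_flipAt_horz, hd.mem_flipAt_vert', hd.mem_flipAt_horz',
    hb.vert, hb.horz, hb.third]
  tauto

theorem IsFlippable.notMem_vert (hf : IsFlippable K v d) :
    ((v + d + d).1 + (-d).1, (v + d + d).2) ∉ K := by
  simpa using hf.vert'

theorem IsFlippable.notMem_horz (hf : IsFlippable K v d) :
    ((v + d + d).1, (v + d + d).2 + (-d).2) ∉ K := by
  simpa using hf.horz'

/-- After the flip there is a branch at the opposite corner, if the degree there is odd. -/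
theorem IsFlippable.exists_isBranch (hd : IsDiag d) (hf : IsFlippable K v d)
    (hodd : Odd (degreeAt K (v + d + d))) :
    ∃ d', IsBranch (flipAt K (v + d)) (v + d + d) d' ∧
      IsTurn (flipAt K (v + d)) (v + d + d) d d' := by
  have hd' := hd.neg
  have hp : v + d + d + -d = v + d := by simp
  have m1 := (hd'.mem_flipAt_vert (K := K) hp).2 hf.notMem_vert
  have m2 := (hd'.mem_flipAt_horz (K := K) hp).2 hf.notMem_horz
  have m3 := hd'.mem_flipAt_vert' (K := K) hp
  have m4 := hd'.mem_flipAt_horz' (K := K) hp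
  rw [hd'.degreeAt_eq] at hodd
  simp only [hf.notMem_vert, hf.notMem_horz, ind_false] at hodd
  rw [← m3, ← m4] at hodd
  set w := v + d + d
  simp only [Prod.fst_neg, Prod.snd_neg, sub_neg_eq_add, ← sub_eq_add_neg] at *
  set K' := flipAt K (v + d)
  -- Both plaquette edges at `w` were absent, so by parity exactly one of the other two is present.
  -- The new direction uses that edge, so the next flip is not the inverse of this one.
  by_cases h3 : (w.1 + d.1, w.2) ∈ K' <;> by_cases h4 : (w.1, w.2 + d.2) ∈ K' <;>
    simp only [h3, h4, ind_true, ind_false] at hodd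
  · exact absurd hodd (by decide)
  · have hb : IsBranch K' w (d.1, -d.2) := ⟨⟨hd.1, hd'.2⟩, h3, by simpa [← sub_eq_add_neg] using m2,
      by simp [m1, h4]⟩
    refine ⟨_, hb, .inr ⟨?_, rfl⟩⟩
    rw [hb.isHorizontal_iff]
    simpa using h4
  · have hb : IsBranch K' w (-d.1, d.2) := ⟨⟨hd'.1, hd.2⟩, by simpa [← sub_eq_add_neg] using m1, h4,
      by simp [m2, h3]⟩
    refine ⟨_, hb, .inl ⟨?_, rfl⟩⟩
    rw [hb.isHorizontal_iff]
    simpa using m2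
  · exact absurd hodd (by decide)

/-- The converse effect at the opposite corner: one edge of each orientation joins a single edge,
whose orientation becomes the majority. -/
theorem isHorizontal_flipAt_of_isBranch {d' : ℤ × ℤ} (hd : IsDiag d) (hf : IsFlippable K v d)
    (hb : IsBranch (flipAt K (v + d)) (v + d + d) d') :
    IsHorizontal (flipAt K (v + d)) (v + d + d) ↔ IsHorizontal K (v + d + d) := by
  have hd' := hd.neg
  have hp : v + d + d + -d = v + d := by simp
  have m1 := (hd'.mem_flipAt_vert (K := K) hp)
  have m2 := (hd'.mem_flipAt_horz (K := K) hp)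
  have m3 := hd'.mem_flipAt_vert' (K := K) hp
  have m4 := hd'.mem_flipAt_horz' (K := K) hp
  have h3 := hb.degreeAt_eq
  rw [hd'.degreeAt_eq] at h3
  rw [hd'.isHorizontal_iff, hd'.isHorizontal_iff]
  simp only [m1, m2, m3, m4, hf.notMem_vert, hf.notMem_horz, not_false_iff, ind_true] at h3 ⊢
  by_cases h5 : ((v + d + d).1 - (-d).1, (v + d + d).2) ∈ K <;>
    by_cases h6 : ((v + d + d).1, (v + d + d).2 - (-d).2) ∈ K <;>
    simp only [h5, h6, ind_true, ind_false] at h3 ⊢ <;> first | omega | simp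

theorem isHorizontal_flipAt {u d' : ℤ × ℤ} (hb : IsBranch K v d) (hf : IsFlippable K v d)
    (hw : IsBranch (flipAt K (v + d)) (v + d + d) d') (hu : SameClass u v) :
    IsHorizontal (flipAt K (v + d)) u ↔ IsHorizontal K u := by
  by_cases huv : u = v
  · exact huv ▸ hb.isHorizontal_flipAt
  by_cases huw : u = v + d + d
  · exact huw ▸ isHorizontal_flipAt_of_isBranch hb.diag hf hw
  exact isHorizontal_congr fun x hx => mem_flipAt_of_sameClass hb.diag hu huv huw hx

end Branch

/-! ### Walks of a branch vertex -/

/-- A sequence of edge sets `K k` with a branch at `v k` which is moved diagonally, by flipping the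
plaquette `v k + d k`. -/
structure IsBranchWalk (K : ℕ → Set (ℤ × ℤ)) (v d : ℕ → ℤ × ℤ) : Prop where
  branch : ∀ k, IsBranch (K k) (v k) (d k)
  flippable : ∀ k, IsFlippable (K k) (v k) (d k)
  set_succ : ∀ k, K (k + 1) = flipAt (K k) (v k + d k)
  vertex_succ : ∀ k, v (k + 1) = v k + d k + d k
  turn : ∀ k, IsTurn (K (k + 1)) (v (k + 1)) (d k) (d (k + 1))

theorem SameClass.symm {u v : ℤ × ℤ} (h : SameClass u v) : SameClass v u :=
  ⟨h.1.symm, h.2.symm⟩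

theorem SameClass.trans {u v w : ℤ × ℤ} (h : SameClass u v) (h' : SameClass v w) :
    SameClass u w :=
  ⟨h.1.trans h'.1, h.2.trans h'.2⟩

namespace IsBranchWalk

variable {K : ℕ → Set (ℤ × ℤ)} {v d : ℕ → ℤ × ℤ}

theorem sameClass (h : IsBranchWalk K v d) (j k : ℕ) : SameClass (v j) (v k) := by
  have key : ∀ k, SameClass (v k) (v 0) := by
    intro k
    induction k with
    | zero => exact ⟨rfl, rfl⟩
    | succ k ih =>
      refine SameClass.trans ?_ ih
      rw [h.vertex_succ]
      have := (h.branch k).diag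
      simp only [SameClass, IsDiag, Prod.fst_add, Prod.snd_add] at *
      omega
  exact (key j).trans (key k).symm

/-- The mirror at a vertex does not change during the walk. -/
theorem isHorizontal_iff (h : IsBranchWalk K v d) (i j k : ℕ) :
    IsHorizontal (K j) (v i) ↔ IsHorizontal (K k) (v i) := by
  have key : ∀ k, IsHorizontal (K k) (v i) ↔ IsHorizontal (K 0) (v i) := by
    intro k
    induction k with
    | zero => rfl
    | succ k ih =>
      rw [← ih, h.set_succ]
      have hb := h.branch (k + 1)
      rw [h.set_succ, h.vertex_succ] at hb
      exact isHorizontal_flipAt (h.branch k) (h.flippable k) hb (h.sameClass i k)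
  rw [key j, key k]

/-- The walk cannot traverse a diagonal in both directions. -/
theorem not_reversed (h : IsBranchWalk K v d) (k m : ℕ) (hv : v k = v (k + m + 1))
    (hd : d k = -d (k + m)) : False := by
  -- Follow the walk forwards from one end and backwards from the other: both meet the same mirrors,
  -- so they trace the same path in opposite directions.
  have key : ∀ i j, i + j = m → v (k + i) = v (k + j + 1) ∧ d (k + i) = -d (k + j) := by
    intro i
    induction i with
    | zero =>
      rintro j hj
      obtain rfl : j = m := by omega
      exact ⟨hv, hd⟩
    | succ i ih =>
      intro j hj
      obtain ⟨h1, h2⟩ := ih (j + 1) (by omega)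
      have hv' : v (k + (i + 1)) = v (k + j + 1) := by
        have e := h.vertex_succ (k + (j + 1))
        rw [← h1] at e
        rw [← add_assoc, h.vertex_succ, h2, e, ← add_assoc]
        abel
      refine ⟨hv', ?_⟩
      have t1 := h.turn (k + i)
      have t2 := h.turn (k + j)
      have hh := h.isHorizontal_iff (k + j + 1) (k + (i + 1)) (k + j + 1)
      rw [add_assoc k i 1, IsTurn, hv', hh, h2] at t1
      unfold IsTurn at t2
      rw [← add_assoc] at t1 ⊢
      rcases t1 with ⟨t1, e1⟩ | ⟨t1, e1⟩ <;> rcases t2 with ⟨t2, e2⟩ | ⟨t2, e2⟩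
      · rw [e1, ← add_assoc, e2]; ext <;> simp
      · exact absurd t1 t2
      · exact absurd t2 t1
      · rw [e1, ← add_assoc, e2]; ext <;> simp
  -- The two ends meet in the middle: for even `m` a step equals its own negative, for odd `m` a
  -- turn reverses the direction, whereas a turn negates only one coordinate.
  rcases Nat.even_or_odd' m with ⟨q, rfl | rfl⟩
  · obtain ⟨-, h2⟩ := key q q (by omega)
    have := (h.branch (k + q)).diag
    have h3 := congrArg Prod.fst h2
    simp only [IsDiag, Prod.fst_neg] at *
    omega
  · obtain ⟨-, h2⟩ := key (q + 1) q (by omega)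
    have h4 := (h.branch (k + q)).diag
    have h3 := congrArg Prod.fst h2
    have h5 := congrArg Prod.snd h2
    have t := h.turn (k + q)
    rw [add_assoc k q 1] at t
    unfold IsTurn at t
    rcases t with ⟨-, t⟩ | ⟨-, t⟩ <;> rw [t] at h3 h5 <;>
    simp only [IsDiag, Prod.fst_neg, Prod.snd_neg] at * <;>
    omega

/-- The edges at a vertex do not change as long as the branch is elsewhere. -/
theorem mem_iff_of_ne (h : IsBranchWalk K v d) {u x : ℤ × ℤ} {k : ℕ} (hu : SameClass u (v 0))
    (hx : x ∈ cross u) (n : ℕ) (hne : ∀ j ≤ n, u ≠ v (k + j)) :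
    x ∈ K (k + n) ↔ x ∈ K k := by
  induction n with
  | zero => rfl
  | succ n ih =>
    rw [← ih fun j hj => hne j (by omega), ← add_assoc, h.set_succ]
    refine mem_flipAt_of_sameClass (h.branch _).diag (hu.trans (h.sameClass _ _))
      (hne n (by omega)) ?_ hx
    rw [← h.vertex_succ]
    exact hne (n + 1) le_rfl

theorem vertex_fst (h : IsBranchWalk K v d) (k : ℕ) :
    (v (k + 1)).1 = (v k).1 + (d k).1 + (d k).1 := by
  rw [h.vertex_succ]; rfl

/-- A branch walk leaves every finite set. -/
theorem not_forall_mem (h : IsBranchWalk K v d) (D : Finset (ℤ × ℤ)) : ¬∀ k, v k ∈ D := by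
  classical
  intro hD
  -- a vertex in the top row among those visited infinitely often
  obtain ⟨u, huD, hu⟩ : ∃ u ∈ D, ∃ᶠ k in Filter.atTop, v k = u := by
    by_contra hcon
    push Not at hcon
    obtain ⟨k, hk⟩ := ((Filter.eventually_all_finset D).2 hcon).exists
    exact hk _ (hD k) rfl
  obtain ⟨u, huS, hmin⟩ := (D.filter fun u => ∃ᶠ k in Filter.atTop, v k = u).exists_min_image
    Prod.fst ⟨u, Finset.mem_filter.2 ⟨huD, hu⟩⟩
  obtain ⟨huD, hu⟩ := Finset.mem_filter.1 huS
  have hrow : ∀ᶠ k in Filter.atTop, u.1 ≤ (v k).1 := by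
    have : ∀ w ∈ D, ∀ᶠ k in Filter.atTop, v k = w → u.1 ≤ w.1 := by
      intro w hw
      by_cases hf : ∃ᶠ k in Filter.atTop, v k = w
      · exact .of_forall fun _ _ => hmin w (Finset.mem_filter.2 ⟨hw, hf⟩)
      · filter_upwards [Filter.not_frequently.1 hf] with k hk hk'
        exact absurd hk' hk
    filter_upwards [(Filter.eventually_all_finset D).2 this] with k hk
    exact hk _ (hD k) rfl
  obtain ⟨N, hN⟩ := Filter.eventually_atTop.1 hrow
  -- The bound `N + 1` puts the preceding vertex `v (k - 1)` in the controlled range too.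
  obtain ⟨k, hk, hku⟩ := (Filter.frequently_atTop.1 hu) (N + 1)
  have hex : ∃ m, v (k + m + 1) = u := by
    obtain ⟨l, hl, hlu⟩ := (Filter.frequently_atTop.1 hu) (k + 1)
    exact ⟨l - (k + 1), by rw [← hlu]; congr 1; omega⟩
  -- the next visit
  obtain ⟨m, hm, hfirst⟩ : ∃ m, v (k + m + 1) = u ∧ ∀ j < m, v (k + j + 1) ≠ u :=
    ⟨Nat.find hex, Nat.find_spec hex, fun j hj => Nat.find_min hex hj⟩
  have diag := fun i => (h.branch i).diag
  -- No smaller row is visited any more, so arrivals at `u` decrease the row and departures increase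
  -- it. Such a turn needs a horizontal mirror.
  have out1 : (d k).1 = 1 := by
    have h1 := hN (k + 1) (by omega)
    rw [h.vertex_fst, hku] at h1
    have := (diag k).1
    omega
  have in1 : (d (k + m)).1 = -1 := by
    have h1 := hN (k + m) (by omega)
    have h2 := h.vertex_fst (k + m)
    rw [hm] at h2
    have := (diag (k + m)).1
    omega
  have in0 : (d (k - 1)).1 = -1 := by
    have h1 := hN (k - 1) (by omega)
    have h2 := h.vertex_fst (k - 1)
    rw [Nat.sub_add_cancel (by omega), hku] at h2
    have := (diag (k - 1)).1
    omega
  have hhor : IsHorizontal (K k) u := by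
    have t := h.turn (k - 1)
    rw [Nat.sub_add_cancel (by omega), hku] at t
    rcases t with ⟨t, -⟩ | ⟨-, t⟩
    · exact t
    · rw [t] at out1
      simp only at out1
      omega
  have hm0 : m ≠ 0 := by
    rintro rfl
    rw [add_zero, out1] at in1
    omega
  obtain ⟨n, rfl⟩ := Nat.exists_eq_succ_of_ne_zero hm0
  have huc : SameClass u (v 0) := hku ▸ h.sameClass k 0
  -- the edge at `u` which is left over after the first visit
  have harm : (u.1, u.2 - (d k).2) ∈ K (k + (n + 1)) := by
    have hx : (u.1, u.2 - (d k).2) ∈ cross u := by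
      have := (diag k).2
      simp only [mem_cross, true_and]
      omega
    have e : k + (n + 1) = k + 1 + n := by omega
    rw [e, h.mem_iff_of_ne huc hx n fun j hj e' => hfirst j (by omega)
      (by rw [e']; congr 1; omega), h.set_succ, hku, (diag k).mem_flipAt_horz' rfl]
    have hb := h.branch k
    rw [hku] at hb
    exact hb.isHorizontal_iff.1 hhor
  -- An arriving flip needs both of its edges at `u` absent beforehand. The left-over edge is still
  -- present, so the arrival is from the side of the last departure.
  have hnot := (h.flippable (k + (n + 1))).notMem_horz
  rw [← h.vertex_succ, hm] at hnot
  have in2 : (d k).2 = -(d (k + (n + 1))).2 := by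
    have h1 := (diag k).2
    have h2 := (diag (k + (n + 1))).2
    by_contra hne
    have e : (d k).2 = (d (k + (n + 1))).2 := by omega
    rw [e] at harm
    exact hnot harm
  refine h.not_reversed k (n + 1) (by rw [hm, hku]) (Prod.ext ?_ in2)
  rw [out1, Prod.fst_neg, in1]
  rfl

end IsBranchWalk

/-! ### The extremal argument -/

/-- Among edge sets with odd degrees at the vertices of `D` that are closed under flips which move
edges at a vertex of `D`, there is one with degree one at the vertices of `D`. -/
theorem exists_degreeAt_eq_one (D : Finset (ℤ × ℤ)) (hD : ∀ v ∈ D, v.1 % 2 = 0 ∧ v.2 % 2 = 0)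
    (F : Set (Set (ℤ × ℤ))) (hF : F.Nonempty) (hodd : ∀ K ∈ F, ∀ v ∈ D, Odd (degreeAt K v))
    (hflip : ∀ K ∈ F, ∀ v ∈ D, ∀ d, IsDiag d → (v.1 + d.1, v.2) ∈ K → (v.1, v.2 + d.2) ∈ K →
      IsFlippable K v d ∧ flipAt K (v + d) ∈ F) :
    ∃ K ∈ F, ∀ v ∈ D, degreeAt K v = 1 := by
  classical
  let T : Set (ℤ × ℤ) → Finset (ℤ × ℤ) := fun K => D.filter fun v => degreeAt K v ≠ 1
  obtain ⟨K₀, hK₀, hmin⟩ : ∃ K₀ ∈ F, ∀ K ∈ F, (T K₀).card ≤ (T K).card :=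
    ⟨_, Function.argminOn_mem (fun K => (T K).card) F hF,
      fun K hK => Function.argminOn_le (fun K => (T K).card) F hK⟩
  by_contra! hcon
  let G : Type := {s : Set (ℤ × ℤ) × (ℤ × ℤ) × (ℤ × ℤ) //
    s.1 ∈ F ∧ (T s.1).card ≤ (T K₀).card ∧ s.2.1 ∈ D ∧ IsBranch s.1 s.2.1 s.2.2}
  obtain ⟨s₀⟩ : Nonempty G := by
    obtain ⟨v, hv, hv1⟩ := hcon K₀ hK₀
    obtain ⟨d, hd⟩ := exists_isBranch (hodd K₀ hK₀ v hv) hv1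
    exact ⟨⟨(K₀, v, d), hK₀, le_rfl, hv, hd⟩⟩
  have step : ∀ s : G, ∃ s' : G, IsFlippable s.1.1 s.1.2.1 s.1.2.2 ∧
      s'.1.1 = flipAt s.1.1 (s.1.2.1 + s.1.2.2) ∧ s'.1.2.1 = s.1.2.1 + s.1.2.2 + s.1.2.2 ∧
      IsTurn s'.1.1 s'.1.2.1 s.1.2.2 s'.1.2.2 := by
    rintro ⟨⟨K, v, d⟩, hK, hT, hv, hb⟩
    simp only at hK hT hv hb
    obtain ⟨hf, hK'⟩ := hflip K hK v hv d hb.diag hb.vert hb.horz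
    set K' := flipAt K (v + d) with hK'def
    have hvT : v ∈ T K := Finset.mem_filter.2 ⟨hv, by rw [hb.degreeAt_eq]; decide⟩
    -- The flip repairs `v` and can spoil only the opposite corner.
    have hsub : T K' ⊆ insert (v + d + d) ((T K).erase v) := by
      intro u hu
      obtain ⟨huD, hu1⟩ := Finset.mem_filter.1 hu
      rw [Finset.mem_insert, or_iff_not_imp_left]
      intro huw
      have huv : u ≠ v := by
        rintro rfl
        exact hu1 hb.degreeAt_flipAt
      refine Finset.mem_erase.2 ⟨huv, Finset.mem_filter.2 ⟨huD, ?_⟩⟩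
      rwa [← degreeAt_flipAt hb.diag hf ((hD u huD).1.trans (hD v hv).1.symm)
        ((hD u huD).2.trans (hD v hv).2.symm) huv huw]
    have hcard := Finset.card_erase_add_one hvT
    -- Otherwise the flip would leave fewer bad vertices than the minimum.
    have hwD : v + d + d ∈ D := by
      by_contra hw
      have : T K' ⊆ (T K).erase v := by
        intro u hu
        refine (Finset.mem_insert.1 (hsub hu)).resolve_left ?_
        rintro rfl
        exact hw (Finset.mem_filter.1 hu).1
      have h1 := Finset.card_le_card this
      have h2 := hmin K' hK'
      omega
    obtain ⟨d', hb', ht⟩ := hf.exists_isBranch hb.diag (hodd K hK _ hwD)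
    refine ⟨⟨(K', v + d + d, d'), hK', ?_, hwD, hb'⟩, hf, rfl, rfl, ht⟩
    have h1 := Finset.card_le_card hsub
    have h2 := Finset.card_insert_le (v + d + d) ((T K).erase v)
    simp only
    omega
  choose next hnext using step
  let f : ℕ → G := fun k => next^[k] s₀
  have hf : ∀ k, f (k + 1) = next (f k) := fun k => Function.iterate_succ_apply' next k s₀
  have hwalk : IsBranchWalk (fun k => (f k).1.1) (fun k => (f k).1.2.1) (fun k => (f k).1.2.2) := by
    refine ⟨fun k => (f k).2.2.2.2, fun k => (hnext (f k)).1, fun k => ?_, fun k => ?_,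
      fun k => ?_⟩ <;> simp only [hf]
    · exact (hnext (f k)).2.1
    · exact (hnext (f k)).2.2.1
    · exact (hnext (f k)).2.2.2
  exact hwalk.not_forall_mem D fun k => (f k).2.2.2.1

/-! ### Parity of symmetric differences -/

theorem card_symmDiff_add {α : Type*} [DecidableEq α] (s t : Finset α) :
    (symmDiff s t).card + 2 * (s ∩ t).card = s.card + t.card := by
  have h1 := Finset.card_sdiff_add_card_inter s t
  have h2 := Finset.card_sdiff_add_card_inter t s
  have h3 : (symmDiff s t).card = (s \ t).card + (t \ s).card :=
    Finset.card_union_of_disjoint disjoint_sdiff_sdiff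
  rw [Finset.inter_comm] at h2
  omega

theorem odd_card_symmDiff {α : Type*} [DecidableEq α] (s t : Finset α) :
    Odd (symmDiff s t).card ↔ ¬(Odd s.card ↔ Odd t.card) := by
  have h := card_symmDiff_add s t
  simp only [Nat.odd_iff]
  omega

theorem odd_card_filter_symmDiff {α : Type*} [DecidableEq α] (s t : Finset α) (P : α → Prop)
    [DecidablePred P] : Odd ((symmDiff s t).filter P).card ↔
      ¬(Odd (s.filter P).card ↔ Odd (t.filter P).card) := by
  rw [← odd_card_symmDiff]
  congr! 2
  ext x
  simp only [Finset.mem_filter, Finset.mem_symmDiff]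
  tauto

theorem odd_jDegree_symmDiff {V : Type*} [DecidableEq V] (J K : Finset (Sym2 V)) (v : V) :
    Odd (jDegree (symmDiff J K) v) ↔ ¬(Odd (jDegree J v) ↔ Odd (jDegree K v)) :=
  odd_card_filter_symmDiff _ _ _

/-! ### Lattice edges as midpoints, and the use of minimality -/

section Lattice

variable {m n : ℕ}

theorem lattice_adj {u v : Vertex m n} : (lattice m n).Adj u v ↔
    (u.1.val = v.1.val ∧ (u.2.val + 1 = v.2.val ∨ v.2.val + 1 = u.2.val)) ∨
      (u.2.val = v.2.val ∧ (u.1.val + 1 = v.1.val ∨ v.1.val + 1 = u.1.val)) := by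
  simp only [lattice, SimpleGraph.boxProd_adj, SimpleGraph.pathGraph_adj, Fin.ext_iff]
  tauto

/-- The midpoint of an edge, in doubled coordinates. -/
def mid : Sym2 (Vertex m n) → ℤ × ℤ :=
  Sym2.lift ⟨fun u v => ((u.1.val : ℤ) + v.1.val, (u.2.val : ℤ) + v.2.val), fun u v => by
    simp only [add_comm]⟩

theorem mid_mk (u v : Vertex m n) :
    mid s(u, v) = ((u.1.val : ℤ) + v.1.val, (u.2.val : ℤ) + v.2.val) := rfl

/-- The midpoints of the edges in a set. -/
def midSet (J : Finset (Sym2 (Vertex m n))) : Set (ℤ × ℤ) := mid '' (J : Set (Sym2 (Vertex m n)))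

theorem mem_midSet {J : Finset (Sym2 (Vertex m n))} {x : ℤ × ℤ} :
    x ∈ midSet J ↔ ∃ e ∈ J, mid e = x := Iff.rfl

/-- A vertex in doubled coordinates. -/
def pt (v : Vertex m n) : ℤ × ℤ := (2 * v.1.val, 2 * v.2.val)

/-- The centre of a plaquette in doubled coordinates. -/
def ctr (p : Plaquette m n) : ℤ × ℤ := (2 * p.1.val + 1, 2 * p.2.val + 1)

/-- The odd coordinate of the midpoint tells the orientation of the edge, and halving then recovers
both ends. -/
theorem mid_injOn : Set.InjOn (mid (m := m) (n := n)) (lattice m n).edgeSet := by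
  intro e he e' he' h
  induction e with | _ a b
  induction e' with | _ a' b'
  obtain ⟨⟨a1, _⟩, ⟨a2, _⟩⟩ := a
  obtain ⟨⟨b1, _⟩, ⟨b2, _⟩⟩ := b
  obtain ⟨⟨c1, _⟩, ⟨c2, _⟩⟩ := a'
  obtain ⟨⟨d1, _⟩, ⟨d2, _⟩⟩ := b'
  simp only [SimpleGraph.mem_edgeSet, lattice_adj, mid_mk, Prod.mk.injEq] at he he' h
  simp only [Sym2.eq_iff, Prod.mk.injEq, Fin.mk.injEq]
  omega

theorem mid_mem_midSet_iff {J : Finset (Sym2 (Vertex m n))}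
    (hJ : ∀ e ∈ J, e ∈ (lattice m n).edgeSet) {e : Sym2 (Vertex m n)}
    (he : e ∈ (lattice m n).edgeSet) : mid e ∈ midSet J ↔ e ∈ J :=
  mid_injOn.mem_image_iff hJ he

theorem midSet_symmDiff {J K : Finset (Sym2 (Vertex m n))}
    (hJ : ∀ e ∈ J, e ∈ (lattice m n).edgeSet) (hK : ∀ e ∈ K, e ∈ (lattice m n).edgeSet) :
    midSet (symmDiff J K) = symmDiff (midSet J) (midSet K) := by
  ext x
  simp only [Set.mem_symmDiff, mem_midSet (J := symmDiff J K), Finset.mem_symmDiff]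
  constructor
  · rintro ⟨e, ⟨h, h'⟩ | ⟨h, h'⟩, rfl⟩
    · exact .inl ⟨⟨e, h, rfl⟩, by rwa [mid_mem_midSet_iff hK (hJ e h)]⟩
    · exact .inr ⟨⟨e, h, rfl⟩, by rwa [mid_mem_midSet_iff hJ (hK e h)]⟩
  · rintro (⟨⟨e, h, rfl⟩, h'⟩ | ⟨⟨e, h, rfl⟩, h'⟩)
    · exact ⟨e, .inl ⟨h, by rwa [mid_mem_midSet_iff hK (hJ e h)] at h'⟩, rfl⟩
    · exact ⟨e, .inr ⟨h, by rwa [mid_mem_midSet_iff hJ (hK e h)] at h'⟩, rfl⟩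

theorem mem_iff_mid_mem_cross {e : Sym2 (Vertex m n)} (he : e ∈ (lattice m n).edgeSet)
    (v : Vertex m n) : v ∈ e ↔ mid e ∈ cross (pt v) := by
  induction e with | _ a b
  obtain ⟨⟨a1, _⟩, ⟨a2, _⟩⟩ := a
  obtain ⟨⟨b1, _⟩, ⟨b2, _⟩⟩ := b
  obtain ⟨⟨c1, _⟩, ⟨c2, _⟩⟩ := v
  simp only [SimpleGraph.mem_edgeSet, lattice_adj, mid_mk, pt, mem_cross, Sym2.mem_iff,
    Prod.mk.injEq, Fin.mk.injEq] at he ⊢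
  omega

theorem plaquetteEdges_subset (p : Plaquette m n) :
    ∀ e ∈ plaquetteEdges p, e ∈ (lattice m n).edgeSet := by
  simp only [plaquetteEdges, Finset.mem_insert, Finset.mem_singleton]
  rintro e (rfl | rfl | rfl | rfl) <;>
    simp [lattice_adj, corner]

theorem midSet_plaquetteEdges (p : Plaquette m n) :
    midSet (plaquetteEdges p) = cross (ctr p) := by
  ext ⟨x, y⟩
  simp only [midSet, plaquetteEdges, Finset.coe_insert, Finset.coe_singleton, Set.image_insert_eq,
    Set.image_singleton, mid_mk, corner, ctr, mem_cross, Set.mem_insert_iff,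
    Set.mem_singleton_iff, Prod.mk.injEq, Fin.val_zero, Fin.val_one, Nat.cast_add, Nat.cast_zero,
    Nat.cast_one]
  omega

theorem mem_plaquetteEdges_iff {e : Sym2 (Vertex m n)} (he : e ∈ (lattice m n).edgeSet)
    (p : Plaquette m n) : e ∈ plaquetteEdges p ↔ mid e ∈ cross (ctr p) := by
  rw [← midSet_plaquetteEdges, mid_mem_midSet_iff (plaquetteEdges_subset p) he]

theorem exists_ctr_eq {v : Vertex m n} {d : ℤ × ℤ} (hd : IsDiag d) {e₁ e₂ : Sym2 (Vertex m n)}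
    (h₁ : mid e₁ = ((pt v).1 + d.1, (pt v).2)) (h₂ : mid e₂ = ((pt v).1, (pt v).2 + d.2)) :
    ∃ p : Plaquette m n, ctr p = pt v + d := by
  induction e₁ with | _ a b
  induction e₂ with | _ a' b'
  obtain ⟨⟨a1, _⟩, ⟨a2, _⟩⟩ := a
  obtain ⟨⟨b1, _⟩, ⟨b2, _⟩⟩ := b
  obtain ⟨⟨c1, _⟩, ⟨c2, _⟩⟩ := a'
  obtain ⟨⟨d1, _⟩, ⟨d2, _⟩⟩ := b'
  obtain ⟨⟨v1, _⟩, ⟨v2, _⟩⟩ := v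
  obtain ⟨s, t⟩ := d
  simp only [mid_mk, pt, IsDiag, Prod.mk.injEq] at hd h₁ h₂
  -- The index is `v1` or `v1 - 1` according to the sign of `s`. The two given edges keep it in
  -- range, so `toNat` truncates nothing.
  refine ⟨(⟨((2 * v1 + s - 1) / 2).toNat, ?_⟩, ⟨((2 * v2 + t - 1) / 2).toNat, ?_⟩), ?_⟩
  · omega
  · omega
  · simp only [ctr, pt, Prod.mk_add_mk, Prod.mk.injEq]
    omega

theorem jDegree_eq_degreeAt {J : Finset (Sym2 (Vertex m n))}
    (hJ : ∀ e ∈ J, e ∈ (lattice m n).edgeSet) (v : Vertex m n) :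
    jDegree J v = degreeAt (midSet J) (pt v) := by
  classical
  let P : Finset (ℤ × ℤ) := {((pt v).1 + 1, (pt v).2), ((pt v).1 - 1, (pt v).2),
    ((pt v).1, (pt v).2 + 1), ((pt v).1, (pt v).2 - 1)}
  have hP : ∀ x, x ∈ P ↔ x ∈ cross (pt v) := by
    rintro ⟨x, y⟩
    simp only [P, Finset.mem_insert, Finset.mem_singleton, mem_cross, Prod.mk.injEq]
    tauto
  have himg : (J.filter fun e => v ∈ e).image mid =
      P.filter (· ∈ midSet J) := by
    ext x
    simp only [Finset.mem_image, Finset.mem_filter, hP, mem_midSet]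
    constructor
    · rintro ⟨e, ⟨he, hv⟩, rfl⟩
      exact ⟨(mem_iff_mid_mem_cross (hJ e he) v).1 hv, e, he, rfl⟩
    · rintro ⟨hx, e, he, rfl⟩
      exact ⟨e, ⟨he, (mem_iff_mid_mem_cross (hJ e he) v).2 hx⟩, rfl⟩
  have hinj : Set.InjOn mid (J.filter fun e => v ∈ e : Set (Sym2 (Vertex m n))) :=
    mid_injOn.mono fun e he => hJ e (Finset.mem_filter.1 he).1
  rw [jDegree, ← Finset.card_image_of_injOn hinj, himg, Finset.card_filter]
  simp only [P]
  rw [Finset.sum_insert, Finset.sum_insert, Finset.sum_insert, Finset.sum_singleton]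
  · simp only [degreeAt, ind]
    ring
  all_goals
    simp only [Finset.mem_insert, Finset.mem_singleton, Prod.mk.injEq]
    omega

variable (A : (lattice m n).Subgraph)

theorem mem_relGraph_edgeSet {e : Sym2 (Vertex m n)} :
    e ∈ (relGraph A).edgeSet ↔ e ∈ (lattice m n).edgeSet ∧ e ∉ A.edgeSet := by
  rw [relGraph, SimpleGraph.edgeSet_deleteEdges]
  rfl

theorem relBoundary_empty : relBoundary A ∅ = ∅ := by
  simp [relBoundary]

theorem relBoundary_symmDiff (c c' : Finset (Plaquette m n)) :
    relBoundary A (symmDiff c c') = symmDiff (relBoundary A c) (relBoundary A c') := by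
  classical
  ext e
  simp only [relBoundary, Finset.mem_filter, Finset.mem_univ, true_and, Finset.mem_symmDiff]
  rw [odd_card_filter_symmDiff]
  tauto

theorem mem_relBoundary_singleton {p : Plaquette m n} {e : Sym2 (Vertex m n)} :
    e ∈ relBoundary A {p} ↔ e ∈ plaquetteEdges p ∧ e ∉ A.edgeSet := by
  classical
  have := plaquetteEdges_subset p e
  simp only [relBoundary, Finset.mem_filter, Finset.mem_univ, true_and, Finset.filter_singleton]
  split_ifs with h <;> simp <;> tauto

theorem relBoundary_subset {c : Finset (Plaquette m n)} {e : Sym2 (Vertex m n)}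
    (he : e ∈ relBoundary A c) : e ∈ (relGraph A).edgeSet := by
  rw [mem_relGraph_edgeSet]
  simp only [relBoundary, Finset.mem_filter] at he
  tauto

variable {A}

theorem notMem_edgeSet_of_notMem_verts {v : Vertex m n} (hv : v ∉ A.verts)
    {e : Sym2 (Vertex m n)} (he : v ∈ e) : e ∉ A.edgeSet :=
  fun h => hv (A.mem_verts_of_mem_edge h he)

theorem even_degreeAt_cross (p : Plaquette m n) (v : Vertex m n) :
    Even (degreeAt (cross (ctr p)) (pt v)) := by
  by_cases h : ∃ d, IsDiag d ∧ pt v + d = ctr p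
  · obtain ⟨d, hd, hp⟩ := h
    -- Seen as a flip of the empty set, the plaquette has exactly two edges at each corner.
    have he : cross (ctr p) = flipAt ∅ (ctr p) := by ext; simp [mem_flipAt]
    rw [he, hd.degreeAt_eq, hd.mem_flipAt_vert hp, hd.mem_flipAt_horz hp, hd.mem_flipAt_vert' hp,
      hd.mem_flipAt_horz' hp]
    simp [ind_true, ind_false]
  · have : degreeAt (cross (ctr p)) (pt v) = degreeAt ∅ (pt v) := by
      refine degreeAt_congr fun x hx => ⟨fun hx' => h ?_, fun h => h.elim⟩
      refine ⟨ctr p - pt v, ?_, by abel⟩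
      obtain ⟨x, y⟩ := x
      simp only [ctr, pt, mem_cross, IsDiag, Prod.mk_sub_mk] at *
      omega
    rw [this]
    simp [degreeAt, ind_false]

/-- Only edges of `A` are dropped from the full boundary, and none of them meets a vertex off `A`.
-/
theorem even_jDegree_relBoundary_singleton (p : Plaquette m n) {v : Vertex m n}
    (hv : v ∉ A.verts) : Even (jDegree (relBoundary A {p}) v) := by
  have h : jDegree (relBoundary A {p}) v = jDegree (plaquetteEdges p) v := by
    unfold jDegree
    congr 1
    ext e
    simp only [Finset.mem_filter, mem_relBoundary_singleton]
    have := notMem_edgeSet_of_notMem_verts (e := e) hv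
    tauto
  rw [h, jDegree_eq_degreeAt (plaquetteEdges_subset p), midSet_plaquetteEdges]
  exact even_degreeAt_cross p v

theorem IsRelJoin.symmDiff_relBoundary_singleton {D : Finset (Vertex m n)}
    (hD : ∀ v ∈ D, v ∉ A.verts) {J : Finset (Sym2 (Vertex m n))}
    (hJ : IsRelJoin (relGraph A) A.verts D J) (p : Plaquette m n) :
    IsRelJoin (relGraph A) A.verts D (symmDiff J (relBoundary A {p})) := by
  have key : ∀ v, v ∉ A.verts →
      (Odd (jDegree (symmDiff J (relBoundary A {p})) v) ↔ Odd (jDegree J v)) := by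
    intro v hv
    rw [odd_jDegree_symmDiff]
    have := Nat.not_odd_iff_even.2 (even_jDegree_relBoundary_singleton p hv)
    tauto
  refine ⟨fun e he => ?_, fun v hv => (key v (hD v hv)).2 (hJ.odd_degree v hv), fun v hv hv' => ?_⟩
  · rcases Finset.mem_symmDiff.1 he with h | h
    · exact hJ.subset_edges e h.1
    · exact relBoundary_subset A h.1
  · rw [← Nat.not_odd_iff_even, key v hv', Nat.not_odd_iff_even]
    exact hJ.even_degree v hv hv'

theorem card_plaquetteEdges_le (p : Plaquette m n) : (plaquetteEdges p).card ≤ 4 :=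
  Finset.card_le_four

/-- If `K` contains `k` edges of the relative boundary `∂p`, the flip changes its size by `|∂p| -
2k`. Minimality gives `2k ≤ |∂p| ≤ 4`, while the two given edges give `k ≥ 2`; hence equality holds
throughout. -/
theorem IsMinRelJoin.isFlippable {D : Finset (Vertex m n)} (hD : ∀ v ∈ D, v ∉ A.verts)
    {K : Finset (Sym2 (Vertex m n))} (hK : IsMinRelJoin (relGraph A) A.verts D K)
    {v : Vertex m n} {d : ℤ × ℤ} (hd : IsDiag d)
    (h₁ : ((pt v).1 + d.1, (pt v).2) ∈ midSet K)
    (h₂ : ((pt v).1, (pt v).2 + d.2) ∈ midSet K) :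
    ∃ p : Plaquette m n, (symmDiff K (relBoundary A {p})).card = K.card ∧
      IsFlippable (midSet K) (pt v) d ∧
      flipAt (midSet K) (pt v + d) =
        midSet (symmDiff K (relBoundary A {p})) := by
  have h₁' := h₁
  have h₂' := h₂
  obtain ⟨e₁, he₁, hm₁⟩ := h₁
  obtain ⟨e₂, he₂, hm₂⟩ := h₂
  have hKl : ∀ e ∈ K, e ∈ (lattice m n).edgeSet := fun e he =>
    ((mem_relGraph_edgeSet A).1 (hK.1.subset_edges e he)).1
  obtain ⟨p, hp⟩ := exists_ctr_eq hd hm₁ hm₂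
  have hd1 := hd.1
  have hd2 := hd.2
  have hb : ∀ e ∈ K, mid e ∈ cross (ctr p) → e ∈ relBoundary A {p} := fun e he hc =>
    (mem_relBoundary_singleton A).2 ⟨(mem_plaquetteEdges_iff (hKl e he) p).2 hc,
      ((mem_relGraph_edgeSet A).1 (hK.1.subset_edges e he)).2⟩
  have hc₁ : mid e₁ ∈ cross (ctr p) := by
    rw [hm₁, hp, mem_cross]
    simp only [Prod.fst_add, Prod.snd_add, true_and]
    omega
  have hc₂ : mid e₂ ∈ cross (ctr p) := by
    rw [hm₂, hp, mem_cross]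
    simp only [Prod.fst_add, Prod.snd_add, true_and]
    omega
  have hne : e₁ ≠ e₂ := by
    rintro rfl
    rw [hm₁, Prod.mk.injEq] at hm₂
    omega
  have hsub : ({e₁, e₂} : Finset _) ⊆ K ∩ relBoundary A {p} := by
    intro e he
    rw [Finset.mem_insert, Finset.mem_singleton] at he
    rcases he with rfl | rfl
    · exact Finset.mem_inter.2 ⟨he₁, hb _ he₁ hc₁⟩
    · exact Finset.mem_inter.2 ⟨he₂, hb _ he₂ hc₂⟩
  have hbsub : relBoundary A {p} ⊆ plaquetteEdges p := fun e he =>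
    ((mem_relBoundary_singleton A).1 he).1
  have hle := hK.2 _ (hK.1.symmDiff_relBoundary_singleton hD p)
  have hcard := card_symmDiff_add K (relBoundary A {p})
  have c1 := Finset.card_le_card hsub
  have c2 := Finset.card_le_card hbsub
  have c3 := card_plaquetteEdges_le p
  rw [Finset.card_pair hne] at c1
  have hinter : K ∩ relBoundary A {p} = {e₁, e₂} :=
    (Finset.eq_of_subset_of_card_le hsub (by rw [Finset.card_pair hne]; omega)).symm
  have hbeq : relBoundary A {p} = plaquetteEdges p :=
    Finset.eq_of_subset_of_card_le hbsub (by omega)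
  have hother : ∀ x ∈ cross (ctr p), x ≠ ((pt v).1 + d.1, (pt v).2) →
      x ≠ ((pt v).1, (pt v).2 + d.2) → x ∉ midSet K := by
    rintro x hx hx₁ hx₂ ⟨e, he, rfl⟩
    have hmem : e ∈ K ∩ relBoundary A {p} := Finset.mem_inter.2 ⟨he, hb e he hx⟩
    rw [hinter, Finset.mem_insert, Finset.mem_singleton] at hmem
    rcases hmem with rfl | rfl
    · exact hx₁ hm₁
    · exact hx₂ hm₂
  refine ⟨p, by omega, ⟨h₁', h₂', hother _ ?_ ?_ ?_, hother _ ?_ ?_ ?_⟩, ?_⟩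
  · rw [hp, mem_cross]
    simp only [Prod.fst_add, Prod.snd_add, true_and]
    omega
  · rw [Ne, Prod.mk.injEq]
    omega
  · rw [Ne, Prod.mk.injEq]
    omega
  · rw [hp, mem_cross]
    simp only [Prod.fst_add, Prod.snd_add, true_and]
    omega
  · rw [Ne, Prod.mk.injEq]
    omega
  · rw [Ne, Prod.mk.injEq]
    omega
  · rw [flipAt, ← hp, ← midSet_plaquetteEdges, hbeq,
      midSet_symmDiff hKl (plaquetteEdges_subset p)]

theorem IsMinRelJoin.exists_jDegree_eq_one {D : Finset (Vertex m n)}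
    (hD : ∀ v ∈ D, v ∉ A.verts) {J : Finset (Sym2 (Vertex m n))}
    (hJ : IsMinRelJoin (relGraph A) A.verts D J) :
    ∃ c : Finset (Plaquette m n), (symmDiff J (relBoundary A c)).card = J.card ∧
      IsMinRelJoin (relGraph A) A.verts D (symmDiff J (relBoundary A c)) ∧
      ∀ v ∈ D, jDegree (symmDiff J (relBoundary A c)) v = 1 := by
  classical
  have hl : ∀ {K : Finset (Sym2 (Vertex m n))}, IsMinRelJoin (relGraph A) A.verts D K →
      ∀ e ∈ K, e ∈ (lattice m n).edgeSet := fun hK e he =>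
    ((mem_relGraph_edgeSet A).1 (hK.1.subset_edges e he)).1
  obtain ⟨_, ⟨c, hc, hmin, rfl⟩, h⟩ := exists_degreeAt_eq_one (D.image pt)
    (by
      intro v hv
      obtain ⟨w, -, rfl⟩ := Finset.mem_image.1 hv
      simp only [pt]
      omega)
    {S | ∃ c : Finset (Plaquette m n), (symmDiff J (relBoundary A c)).card = J.card ∧
      IsMinRelJoin (relGraph A) A.verts D (symmDiff J (relBoundary A c)) ∧
      S = midSet (symmDiff J (relBoundary A c))}
    ⟨_, ∅, by rw [relBoundary_empty, ← Finset.bot_eq_empty, symmDiff_bot],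
      by rwa [relBoundary_empty, ← Finset.bot_eq_empty, symmDiff_bot], rfl⟩
    (by
      rintro _ ⟨c, -, hmin, rfl⟩ v hv
      obtain ⟨w, hw, rfl⟩ := Finset.mem_image.1 hv
      rw [← jDegree_eq_degreeAt (hl hmin)]
      exact hmin.1.odd_degree w hw)
    (by
      rintro _ ⟨c, hc, hmin, rfl⟩ v hv d hd h₁ h₂
      obtain ⟨w, -, rfl⟩ := Finset.mem_image.1 hv
      obtain ⟨p, hp, hf, he⟩ := hmin.isFlippable hD hd h₁ h₂
      refine ⟨hf, symmDiff c {p}, ?_⟩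
      rw [relBoundary_symmDiff, ← symmDiff_assoc]
      refine ⟨hp.trans hc, ⟨hmin.1.symmDiff_relBoundary_singleton hD p, ?_⟩, he⟩
      rw [hp]
      exact hmin.2)
  refine ⟨c, hc, hmin, fun v hv => ?_⟩
  rw [jDegree_eq_degreeAt (hl hmin)]
  exact h _ (Finset.mem_image_of_mem pt hv)

end Lattice

/-! ### Existence of minimum relative joins -/

section Existence

variable {V : Type*} [DecidableEq V] {G : SimpleGraph V} {B : Set V}

/-- Off `B`, the vertices of odd `J`-degree are those of `D`. -/
def IsParityJoin (G : SimpleGraph V) (B : Set V) (D : Finset V) (J : Finset (Sym2 V)) : Prop :=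
  (∀ e ∈ J, e ∈ G.edgeSet) ∧ ∀ v, v ∉ B → (Odd (jDegree J v) ↔ v ∈ D)

theorem IsParityJoin.isRelJoin {D : Finset V} {J : Finset (Sym2 V)} (h : IsParityJoin G B D J)
    (hD : ∀ v ∈ D, v ∉ B) : IsRelJoin G B D J :=
  ⟨h.1, fun v hv => (h.2 v (hD v hv)).2 hv, fun v hv hB => by
    rw [← Nat.not_odd_iff_even, h.2 v hB]; exact hv⟩

theorem IsParityJoin.symmDiff {D D' : Finset V} {J J' : Finset (Sym2 V)}
    (h : IsParityJoin G B D J) (h' : IsParityJoin G B D' J') :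
    IsParityJoin G B (symmDiff D D') (symmDiff J J') := by
  refine ⟨fun e he => ?_, fun v hv => ?_⟩
  · rcases Finset.mem_symmDiff.1 he with he | he
    · exact h.1 e he.1
    · exact h'.1 e he.1
  · rw [odd_jDegree_symmDiff, h.2 v hv, h'.2 v hv, Finset.mem_symmDiff]
    tauto

theorem isParityJoin_empty : IsParityJoin G B ∅ ∅ := by
  simp [IsParityJoin, jDegree]

theorem isParityJoin_edge {u v : V} (h : G.Adj u v) : IsParityJoin G B {u, v} {s(u, v)} := by
  refine ⟨by simpa using h, fun w _ => ?_⟩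
  simp only [jDegree, Finset.filter_singleton, Sym2.mem_iff, Finset.mem_insert,
    Finset.mem_singleton]
  split_ifs with hw <;> simp [hw]

/-- Modulo 2, the edges of a walk from `v` to `b` have odd degree at most at its ends, and `b` is
exempt. -/
theorem exists_isParityJoin_singleton {v b : V} (hb : b ∈ B) (h : G.Reachable v b) :
    ∃ J, IsParityJoin G B {v} J := by
  obtain ⟨w⟩ := h
  induction w with
  | nil =>
    refine ⟨∅, by simp, fun w hw => ?_⟩
    simp only [jDegree, Finset.filter_empty, Finset.card_empty, Finset.mem_singleton]
    exact iff_of_false (by decide) fun e => hw (e ▸ hb)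
  | @cons u x _ hadj _ ih =>
    obtain ⟨J, hJ⟩ := ih hb
    have e : ({u} : Finset V) = symmDiff {u, x} {x} := by
      ext w
      have := hadj.ne
      simp only [Finset.mem_symmDiff, Finset.mem_insert, Finset.mem_singleton]
      grind
    exact ⟨_, e ▸ (isParityJoin_edge hadj).symmDiff hJ⟩

/-- If every vertex is connected to `B`, then relative joins exist. -/
theorem exists_isRelJoin (hG : ∀ v, ∃ b ∈ B, G.Reachable v b) (D : Finset V)
    (hD : ∀ v ∈ D, v ∉ B) : ∃ J, IsRelJoin G B D J := by
  suffices ∃ J, IsParityJoin G B D J from this.imp fun J hJ => hJ.isRelJoin hD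
  clear hD
  induction D using Finset.induction_on with
  | empty => exact ⟨∅, isParityJoin_empty⟩
  | insert v D hv ih =>
    obtain ⟨J, hJ⟩ := ih
    obtain ⟨b, hb, hr⟩ := hG v
    obtain ⟨K, hK⟩ := exists_isParityJoin_singleton hb hr
    refine ⟨symmDiff K J, ?_⟩
    have e : insert v D = symmDiff {v} D := by
      ext w
      simp only [Finset.mem_symmDiff, Finset.mem_insert, Finset.mem_singleton]
      grind
    rw [e]
    exact hK.symmDiff hJ

theorem exists_isMinRelJoin (hG : ∀ v, ∃ b ∈ B, G.Reachable v b) (D : Finset V)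
    (hD : ∀ v ∈ D, v ∉ B) : ∃ J, IsMinRelJoin G B D J := by
  have h : {J | IsRelJoin G B D J}.Nonempty := exists_isRelJoin hG D hD
  exact ⟨_, Function.argminOn_mem Finset.card _ h, fun K hK => Function.argminOn_le Finset.card _ hK⟩

end Existence

/-! ### The primal and dual sides -/

theorem reachable_primalSides (L : ℕ) (v : Vertex L (L + 1)) :
    ∃ b ∈ (primalSides L).verts, (relGraph (primalSides L)).Reachable v b := by
  obtain ⟨i, j, hj⟩ := v
  refine ⟨(i, 0), .inl rfl, ?_⟩
  -- Walk along the row to column 0; edges within a row are never removed.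
  induction j with
  | zero => exact .rfl
  | succ j ih =>
    refine .trans (SimpleGraph.Adj.reachable ?_) (ih (by omega))
    rw [← SimpleGraph.mem_edgeSet, mem_relGraph_edgeSet]
    refine ⟨lattice_adj.2 (by simp), fun h => ?_⟩
    have := congrArg Fin.val h.2.1
    simp at this

theorem reachable_dualSides (L : ℕ) (v : Vertex (L + 1) L) :
    ∃ b ∈ (dualSides L).verts, (relGraph (dualSides L)).Reachable v b := by
  obtain ⟨⟨i, hi⟩, j⟩ := v
  refine ⟨(0, j), .inl rfl, ?_⟩
  induction i with
  | zero => exact .rfl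
  | succ i ih =>
    refine .trans (SimpleGraph.Adj.reachable ?_) (ih (by omega))
    rw [← SimpleGraph.mem_edgeSet, mem_relGraph_edgeSet]
    refine ⟨lattice_adj.2 (by simp), fun h => ?_⟩
    have := congrArg Fin.val h.2.1
    simp at this

theorem exists_jDegree_eq_one_and_forall {m n : ℕ} (A : (lattice m n).Subgraph)
    (hA : ∀ v, ∃ b ∈ A.verts, (relGraph A).Reachable v b) (D : Finset (Vertex m n))
    (hD : ∀ v ∈ D, v ∉ A.verts) :
    (∃ J, IsMinRelJoin (relGraph A) A.verts D J ∧ ∀ v ∈ D, jDegree J v = 1) ∧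
      ∀ J, IsMinRelJoin (relGraph A) A.verts D J → ∃ c : Finset (Plaquette m n),
        (symmDiff J (relBoundary A c)).card = J.card ∧
          ∀ v ∈ D, jDegree (symmDiff J (relBoundary A c)) v = 1 := by
  constructor
  · obtain ⟨J, hJ⟩ := exists_isMinRelJoin hA D hD
    obtain ⟨c, -, hc⟩ := hJ.exists_jDegree_eq_one hD
    exact ⟨_, hc⟩
  · intro J hJ
    obtain ⟨c, hc, -, h⟩ := hJ.exists_jDegree_eq_one hD
    exact ⟨c, hc, h⟩

end PlanarCode

theorem theorem3p2 (L : ℕ) (hL : 3 ≤ L) :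
    -- the primal lattice
    (∀ D : Finset (PlanarCode.Vertex L (L + 1)),
      (∀ v ∈ D, v ∉ (PlanarCode.primalSides L).verts) →
      (∃ J, PlanarCode.IsMinRelJoin (PlanarCode.relGraph (PlanarCode.primalSides L))
          (PlanarCode.primalSides L).verts D J ∧
        ∀ v ∈ D, PlanarCode.jDegree J v = 1) ∧
      ∀ J, PlanarCode.IsMinRelJoin (PlanarCode.relGraph (PlanarCode.primalSides L))
          (PlanarCode.primalSides L).verts D J →
        ∃ c : Finset (PlanarCode.Plaquette L (L + 1)),
          (symmDiff J (PlanarCode.relBoundary (PlanarCode.primalSides L) c)).card = J.card ∧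
          ∀ v ∈ D,
            PlanarCode.jDegree
              (symmDiff J (PlanarCode.relBoundary (PlanarCode.primalSides L) c)) v = 1) ∧
    -- the dual lattice
    (∀ D : Finset (PlanarCode.Vertex (L + 1) L),
      (∀ v ∈ D, v ∉ (PlanarCode.dualSides L).verts) →
      (∃ J, PlanarCode.IsMinRelJoin (PlanarCode.relGraph (PlanarCode.dualSides L))
          (PlanarCode.dualSides L).verts D J ∧
        ∀ v ∈ D, PlanarCode.jDegree J v = 1) ∧
      ∀ J, PlanarCode.IsMinRelJoin (PlanarCode.relGraph (PlanarCode.dualSides L))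
          (PlanarCode.dualSides L).verts D J →
        ∃ c : Finset (PlanarCode.Plaquette (L + 1) L),
          (symmDiff J (PlanarCode.relBoundary (PlanarCode.dualSides L) c)).card = J.card ∧
          ∀ v ∈ D,
            PlanarCode.jDegree
              (symmDiff J (PlanarCode.relBoundary (PlanarCode.dualSides L) c)) v = 1) :=
  ⟨fun D hD => PlanarCode.exists_jDegree_eq_one_and_forall _ (PlanarCode.reachable_primalSides L) D hD,
    fun D hD => PlanarCode.exists_jDegree_eq_one_and_forall _ (PlanarCode.reachable_dualSides L) D hD⟩
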